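/- **Setting.** A *regular Feller diffusion* on $[0,1]$ with coefficients $a,b\in C((0,1))$, $b>0$ on $(0,1)$, is a Markov process with continuous paths in $[0,1]$ and some initial distribution, whose transition semigroup $(T_t)_{t\ge 0}$ is a Feller semigroup on $C([0,1])$ (strongly continuous, positive, $T_t1=1$), such that every interior point is hit with positive probability from every other interior point, and whose infinitesimal generator $A$, with domain $\mathcal D_A\subset C([0,1])$ (the $f$ for which $(T_tf-f)/t$ converges uniformly as $t\downarrow0$), satisfies, for every $f\in\mathcal D_A$: $f\in C^2((0,1))$ and $(Af)(x)=\tfrac12 b(x)f''(x)+a(x)f'(x)$ for $x\in(0,1)$. Put $$s(x)=\exp\Big(-\int_{1/2}^x\frac{2a(y)}{b(y)}\,dy\Big),\quad S(x)=\int_{1/2}^x s(y)\,dy,\quad m(x)=\frac1{s(x)b(x)},\quad M(x)=\int_{1/2}^x m(y)\,dy ,$$ and, for $x\in(0,1)$, $$N(0)=\int_{(0,x]}[S(x)-S(\eta)]\,dM(\eta),\qquad \Sigma(0)=\int_{(0,x]}[M(x)-M(\eta)]\,dS(\eta),$$ $$N(1)=\int_{[x,1)}[S(\eta)-S(x)]\,dM(\eta),\qquad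 \Sigma(1)=\int_{[x,1)}[M(\eta)-M(x)]\,dS(\eta)$$ (whether these are finite does not depend on $x$). An endpoint $e\in\{0,1\}$ is *regular* if $N(e)<\infty$ and $\Sigma(e)<\infty$, and an *entrance* boundary if $N(e)<\infty$ and $\Sigma(e)=\infty$. A regular endpoint $e$ is *instantaneously reflecting* if $f'(x)/s(x)\to0$ as $x\to e$ within $(0,1)$ for all $f\in\mathcal D_A$, and *absorbing* if $(Af)(e)=0$ for all $f\in\mathcal D_A$. Let $X$ be a regular Feller diffusion on $[0,1]$ with coefficients $a,b$, generator $A$ and initial distribution $\Pi_0$, for which $0$ and $1$ are instantaneously reflecting. Then $m$ is integrable on $(0,1)$; put $\pi=m/\int_0^1m$, $\Pi(x)=\int_0^x\pi(y)\,dy$, and, for bounded measurable $f$ on $[0,1]$, $$(\Lambda f)(x)=\int_0^x\frac{\pi(y)}{\Pi(x)}f(y)\,dy\quad(0<x\le1),\qquad(\Lambda f)(0)=f(0).$$ A regular Feller diffusion $X^*$ on $[0,1]$ (with some coefficients $a^*,b^*$ as above, generator $A^*$ and initial distribution $\Pi_0^*$) is a *strong stationary dual* of $X$ if $\Lambda$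 maps $\mathcal D_A$ into $\mathcal D_{A^*}$, $\Lambda A=A^*\Lambda$ on $\mathcal D_A$, and $\int f\,d\Pi_0=\int\Lambda f\,d\Pi_0^*$ for all bounded measurable $f$ on $[0,1]$. **Theorem.** Let $X$ be as above and assume in addition that $b\in C^1((0,1))$. If $X^*$ is a strong stationary dual of $X$, then for all $f\in\mathcal D_{A^*}$ and $x\in(0,1)$ $$(A^*f)(x)=\Big(\tfrac12b'(x)-a(x)+b(x)\frac{\pi(x)}{\Pi(x)}\Big)f'(x)+\tfrac12b(x)f''(x).$$ Moreover, $0$ is an entrance boundary for $X^*$, and $1$ is a regular absorbing boundary for $X^*$. -/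

import Mathlib

open Set Filter Topology MeasureTheory ProbabilityTheory
open scoped NNReal ENNReal

noncomputable section

namespace StrongStationary

/-- A (conservative) Feller semigroup on `C([0,1])`: a strongly continuous semigroup of positive
operators preserving the constant function `1`. -/
structure FellerSemigroup where
  T : ℝ≥0 → C(unitInterval, ℝ) →L[ℝ] C(unitInterval, ℝ)
  map_zero : T 0 = ContinuousLinearMap.id ℝ _
  map_add : ∀ s t, T (s + t) = (T s).comp (T t)
  map_nonneg : ∀ t f, 0 ≤ f → 0 ≤ T t f
  map_one : ∀ t, T t 1 = 1
  strongly_continuous : ∀ f, Tendsto (fun t => T t f) (𝓝 0) (𝓝 f)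

namespace FellerSemigroup

/-- The difference quotient `(T_t f - f) / t`. -/
def quotient (F : FellerSemigroup) (f : C(unitInterval, ℝ)) (t : ℝ≥0) : C(unitInterval, ℝ) :=
  (t : ℝ)⁻¹ • (F.T t f - f)

/-- The domain of the infinitesimal generator: all `f` for which `(T_t f - f) / t` converges
uniformly as `t ↓ 0`. -/
def domain (F : FellerSemigroup) : Set C(unitInterval, ℝ) :=
  {f | ∃ g, Tendsto (F.quotient f) (𝓝[>] 0) (𝓝 g)}

/-- The infinitesimal generator (meaningful on `domain`). -/
def generator (F : FellerSemigroup) (f : C(unitInterval, ℝ)) : C(unitInterval, ℝ) :=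
  limUnder (𝓝[>] 0) (F.quotient f)

end FellerSemigroup

/-- A function on `[0,1]`, read as a function on `ℝ` (extended by constants outside `[0,1]`;
only its values on `[0,1]` are ever used). -/
def onReal (f : unitInterval → ℝ) : ℝ → ℝ := Set.IccExtend zero_le_one f

/-- A regular Feller diffusion on `[0,1]`, with initial distribution `init` and with generator
`½ b f'' + a f'` in the interior. The process is given by the coordinate maps `X t` on `Ω`, the
laws `P x` for the starting points `x`, and its transition semigroup `T`. -/
structure Diffusion (Ω : Type*) [MeasurableSpace Ω] extends FellerSemigroup where
  /-- the drift coefficient -/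
  a : ℝ → ℝ
  /-- the diffusion coefficient -/
  b : ℝ → ℝ
  continuousOn_a : ContinuousOn a (Ioo 0 1)
  continuousOn_b : ContinuousOn b (Ioo 0 1)
  b_pos : ∀ x ∈ Ioo (0 : ℝ) 1, 0 < b x
  contDiffOn_of_mem_domain : ∀ f ∈ toFellerSemigroup.domain,
    ContDiffOn ℝ 2 (onReal f) (Ioo 0 1)
  generator_eq : ∀ f ∈ toFellerSemigroup.domain, ∀ x : unitInterval, (x : ℝ) ∈ Ioo (0 : ℝ) 1 →
    toFellerSemigroup.generator f x =
      1 / 2 * b x * deriv (deriv (onReal f)) x + a x * deriv (onReal f) x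
  /-- the process -/
  X : ℝ≥0 → Ω → unitInterval
  measurable_X : ∀ t, Measurable (X t)
  continuous_X : ∀ ω, Continuous fun t => X t ω
  /-- the law of the process started at a point -/
  P : Kernel unitInterval Ω
  isMarkovKernel_P : IsMarkovKernel P
  start : ∀ x, ∀ᵐ ω ∂(P x), X 0 ω = x
  markov : ∀ (x : unitInterval) (s t : ℝ≥0) (f : C(unitInterval, ℝ)),
    (P x)[fun ω => f (X (s + t) ω) |
        Filtration.natural X (fun r => (measurable_X r).stronglyMeasurable) s]
      =ᵐ[P x] fun ω => T t f (X s ω)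
  /-- regularity: every interior point is hit with positive probability from every other one -/
  regular : ∀ x y : unitInterval, (x : ℝ) ∈ Ioo (0 : ℝ) 1 → (y : ℝ) ∈ Ioo (0 : ℝ) 1 →
    0 < P x {ω | ∃ t, X t ω = y}
  /-- the initial distribution -/
  init : Measure unitInterval
  isProbabilityMeasure_init : IsProbabilityMeasure init

namespace Diffusion

variable {Ω : Type*} [MeasurableSpace Ω] (D : Diffusion Ω)

/-- The density `s = S'` of the scale function. -/
def s (x : ℝ) : ℝ := Real.exp (-∫ y in (1 / 2 : ℝ)..x, 2 * D.a y / D.b y)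

/-- The scale function `S` on `(0,1)`, normalised by `S (1/2) = 0`. -/
def S (x : ℝ) : ℝ := ∫ y in (1 / 2 : ℝ)..x, D.s y

/-- The density `m` of the speed measure on `(0,1)`. -/
def m (x : ℝ) : ℝ := (D.s x * D.b x)⁻¹

/-- The speed function `M` on `(0,1)`, normalised by `M (1/2) = 0`. -/
def M (x : ℝ) : ℝ := ∫ y in (1 / 2 : ℝ)..x, D.m y

/-- `N(0) = ∫_{(0,x]} [S(x) - S(η)] M(dη)`. -/
def N₀ (x : ℝ) : ℝ≥0∞ := ∫⁻ η in Ioc 0 x, ENNReal.ofReal ((D.S x - D.S η) * D.m η)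

/-- `Σ(0) = ∫_{(0,x]} [M(x) - M(η)] dS(η)`. -/
def Sigma₀ (x : ℝ) : ℝ≥0∞ := ∫⁻ η in Ioc 0 x, ENNReal.ofReal ((D.M x - D.M η) * D.s η)

/-- `N(1) = ∫_{[x,1)} [S(η) - S(x)] M(dη)`. -/
def N₁ (x : ℝ) : ℝ≥0∞ := ∫⁻ η in Ico x 1, ENNReal.ofReal ((D.S η - D.S x) * D.m η)

/-- `Σ(1) = ∫_{[x,1)} [M(η) - M(x)] dS(η)`. -/
def Sigma₁ (x : ℝ) : ℝ≥0∞ := ∫⁻ η in Ico x 1, ENNReal.ofReal ((D.M η - D.M x) * D.s η)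

/-- `0` is a regular boundary (whether the integrals are finite does not depend on `x`). -/
def IsRegularAtZero : Prop := ∀ x ∈ Ioo (0 : ℝ) 1, D.N₀ x < ∞ ∧ D.Sigma₀ x < ∞

/-- `1` is a regular boundary. -/
def IsRegularAtOne : Prop := ∀ x ∈ Ioo (0 : ℝ) 1, D.N₁ x < ∞ ∧ D.Sigma₁ x < ∞

/-- `0` is an entrance boundary. -/
def IsEntranceAtZero : Prop := ∀ x ∈ Ioo (0 : ℝ) 1, D.N₀ x < ∞ ∧ D.Sigma₀ x = ∞

/-- `0` is an instantaneously reflecting (regular) boundary: `df/dS⁺(0) = 0` on the domain of the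
generator. -/
def IsReflectingAtZero : Prop :=
  D.IsRegularAtZero ∧ ∀ f ∈ D.domain,
    Tendsto (fun x => deriv (onReal f) x / D.s x) (𝓝[>] 0) (𝓝 0)

/-- `1` is an instantaneously reflecting (regular) boundary: `df/dS⁻(1) = 0` on the domain of the
generator. -/
def IsReflectingAtOne : Prop :=
  D.IsRegularAtOne ∧ ∀ f ∈ D.domain,
    Tendsto (fun x => deriv (onReal f) x / D.s x) (𝓝[<] 1) (𝓝 0)

/-- `1` is an absorbing boundary: `(A f)(1) = 0` on the domain of the generator `A`. -/
def IsAbsorbingAtOne : Prop := ∀ f ∈ D.domain, D.generator f 1 = 0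

/-- The stationary density `π`: the speed density `m`, normalised to total mass `1`. -/
def statDensity (x : ℝ) : ℝ := D.m x / ∫ y in Ioo (0 : ℝ) 1, D.m y

/-- The stationary distribution function `Π(x) = ∫_0^x π`. -/
def statCDF (x : ℝ) : ℝ := ∫ y in (0 : ℝ)..x, D.statDensity y

open Classical in
/-- The integral operator `Λ`, whose kernel is the stationary distribution conditioned
on `(0,x]`. -/
def link (f : unitInterval → ℝ) (x : unitInterval) : ℝ :=
  if x = 0 then f 0
  else ∫ y in (0 : ℝ)..x, D.statDensity y / D.statCDF x * onReal f y

/-- `D'` is a strong stationary dual of `D`: `Λ` maps the domain of `A` into that of `A*`,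
`Λ A = A* Λ` on the domain of `A`, and `(Π₀, f) = (Π₀*, Λ f)` for bounded measurable `f`. -/
def IsStrongStationaryDual {Ω' : Type*} [MeasurableSpace Ω'] (D : Diffusion Ω)
    (D' : Diffusion Ω') : Prop :=
  (∀ f ∈ D.domain, ∃ g ∈ D'.domain, ⇑g = D.link f ∧ ⇑(D'.generator g) = D.link (D.generator f)) ∧
  ∀ f : unitInterval → ℝ, Measurable f → (∃ C, ∀ x, |f x| ≤ C) →
    ∫ x, f x ∂D.init = ∫ x, D.link f x ∂D'.init

end Diffusion

end StrongStationary

end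

/-!
The generator of a diffusion is `A f = (f' / s)' / (2 m)`, with scale density `s` and speed
density `m`. Regularity of the endpoints makes `s` and `m` integrable on `(0,1)`
(`integrableOn_s`, `integrableOn_m`).

**The domain of `A` is large.** For any Feller semigroup, `1 - A` maps the domain onto `C([0,1])`
(`exists_sub_generator_eq`). If both endpoints are reflecting, `1 - A` is injective even on the a
priori larger set of all `f` with `A f` continuous on `[0,1]` and `f' / s → 0` at both ends:
if `A d = d` and `w = d' / s`, then `d w` is nondecreasing and vanishes at both ends
(`eq_zero_of_reflecting`). So the domain is this whole set, and `f' / s` can be prescribed to be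
any compactly supported `C¹` function (`exists_mem_domain_hasDerivAt`).

**The coefficients.** Since `(Λ f)' = (π / Π) (f - Λ f)`, and since `Λ A f` is a multiple of
`f' / (s Π)`, the equation `A* Λ f = Λ A f` at an interior point is a linear relation between `f'`
and `f - Λ f` (`coefficient_relation`). Bumps for `f' / s` show that both coefficients of this
relation vanish, which determines `a*` and `b*` (`dual_coefficients`).

**The boundary types.** It follows that `s*` is a multiple of `π / Π²` and `m*` a multiple
of `s Π²` (`exists_dual_s_eq`). As `Π` vanishes at `0` only, `0` is an entrance boundary
and `1` is regular.

**Absorption at `1`.** For `f` in the domain of `A`, `(A* Λ f)(1) = ∫ π A f = 0`. Such `Λ f` form a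
core of `A*`, because `(1 - A*) Λ f = Λ (1 - A) f` ranges over `Λ (C([0,1]))`, and this is dense: it
contains every `C¹` function `G` that is constant near both ends, namely as the image of
`G + G' Π / π` (`exists_link_near`). Hence `(A* g)(1) = 0` on the whole domain of `A*`
(`dual_isAbsorbingAtOne`).
-/

noncomputable section

namespace StrongStationary

/-! ### Feller semigroups: contraction, resolvent, dissipativity -/

namespace FellerSemigroup

variable (F : FellerSemigroup)

lemma norm_T_apply_le (t : ℝ≥0) (f : C(unitInterval, ℝ)) : ‖F.T t f‖ ≤ ‖f‖ := by
  rw [ContinuousMap.norm_le _ (norm_nonneg f)]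
  intro x
  have h1 : 0 ≤ F.T t (‖f‖ • 1 - f) x := F.map_nonneg t (‖f‖ • 1 - f) (fun y => by
    have := (abs_le.1 (f.norm_coe_le_norm y)).2
    change (0 : ℝ) ≤ ‖f‖ * 1 - f y
    linarith) x
  have h2 : 0 ≤ F.T t (‖f‖ • 1 + f) x := F.map_nonneg t (‖f‖ • 1 + f) (fun y => by
    have := (abs_le.1 (f.norm_coe_le_norm y)).1
    change (0 : ℝ) ≤ ‖f‖ * 1 + f y
    linarith) x
  rw [map_sub, map_smul, F.map_one] at h1
  rw [_root_.map_add, map_smul, F.map_one] at h2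
  change 0 ≤ ‖f‖ * 1 - F.T t f x at h1
  change 0 ≤ ‖f‖ * 1 + F.T t f x at h2
  rw [Real.norm_eq_abs, abs_le]
  constructor <;> linarith

lemma continuous_orbit (f : C(unitInterval, ℝ)) : Continuous fun t => F.T t f := by
  -- For `s ≤ t`, `‖T_t f - T_s f‖ ≤ ‖T_{t-s} f - f‖`; the truncated differences cover both orders.
  have key : ∀ s t : ℝ≥0, ‖F.T t f - F.T s f‖ ≤ ‖F.T ((t - s) + (s - t)) f - f‖ := by
    intro s t
    rcases le_total s t with h | h
    · obtain ⟨r, rfl⟩ := exists_add_of_le h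
      have : (s + r - s) + (s - (s + r)) = r := by
        rw [add_tsub_cancel_left, tsub_eq_zero_of_le h, add_zero]
      rw [this, F.map_add, ContinuousLinearMap.comp_apply, ← map_sub]
      exact F.norm_T_apply_le _ _
    · obtain ⟨r, rfl⟩ := exists_add_of_le h
      have : (t - (t + r)) + (t + r - t) = r := by
        rw [add_tsub_cancel_left, tsub_eq_zero_of_le h, zero_add]
      rw [this, F.map_add, ContinuousLinearMap.comp_apply, ← map_sub, norm_sub_rev _ f]
      exact F.norm_T_apply_le _ _
  rw [continuous_iff_continuousAt]
  intro s
  rw [ContinuousAt, tendsto_iff_norm_sub_tendsto_zero]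
  refine squeeze_zero (fun _ => norm_nonneg _) (key s) ?_
  have h1 : Tendsto (fun t : ℝ≥0 => (t - s) + (s - t)) (𝓝 s) (𝓝 0) := by
    have : Continuous fun t : ℝ≥0 => (t - s) + (s - t) := by fun_prop
    simpa using this.tendsto s
  have h2 := ((F.strongly_continuous f).comp h1).sub_const f
  simpa using h2.norm

lemma generator_eq_of_tendsto {f g : C(unitInterval, ℝ)}
    (h : Tendsto (F.quotient f) (𝓝[>] 0) (𝓝 g)) : F.generator f = g :=
  h.limUnder_eq

lemma tendsto_generator {f : C(unitInterval, ℝ)} (hf : f ∈ F.domain) :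
    Tendsto (F.quotient f) (𝓝[>] 0) (𝓝 (F.generator f)) := by
  obtain ⟨g, hg⟩ := hf
  rwa [F.generator_eq_of_tendsto hg]

lemma tendsto_quotient_sub {f g : C(unitInterval, ℝ)} (hf : f ∈ F.domain) (hg : g ∈ F.domain) :
    Tendsto (F.quotient (f - g)) (𝓝[>] 0) (𝓝 (F.generator f - F.generator g)) := by
  refine ((F.tendsto_generator hf).sub (F.tendsto_generator hg)).congr fun t => ?_
  simp only [quotient, map_sub, ← smul_sub]
  congr 1
  abel

lemma sub_mem_domain {f g : C(unitInterval, ℝ)} (hf : f ∈ F.domain) (hg : g ∈ F.domain) :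
    f - g ∈ F.domain :=
  ⟨_, F.tendsto_quotient_sub hf hg⟩

lemma generator_sub {f g : C(unitInterval, ℝ)} (hf : f ∈ F.domain) (hg : g ∈ F.domain) :
    F.generator (f - g) = F.generator f - F.generator g :=
  F.generator_eq_of_tendsto (F.tendsto_quotient_sub hf hg)

/-- The generator of a contraction semigroup is dissipative. -/
lemma norm_le_norm_sub_generator {f : C(unitInterval, ℝ)} (hf : f ∈ F.domain) :
    ‖f‖ ≤ ‖f - F.generator f‖ := by
  refine ge_of_tendsto ((F.tendsto_generator hf).const_sub f).norm ?_
  filter_upwards [self_mem_nhdsWithin] with t ht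
  have ht' : (0 : ℝ) < t := ht
  have h1 : f - F.quotient f t = (1 + (t : ℝ)⁻¹) • f - (t : ℝ)⁻¹ • F.T t f := by
    simp only [quotient, smul_sub, add_smul, one_smul]
    abel
  have h2 := norm_sub_norm_le ((1 + (t : ℝ)⁻¹) • f) ((t : ℝ)⁻¹ • F.T t f)
  rw [← h1, norm_smul, norm_smul, Real.norm_of_nonneg (by positivity),
    Real.norm_of_nonneg (by positivity)] at h2
  have h3 := mul_le_mul_of_nonneg_left (F.norm_T_apply_le t f) (inv_nonneg.2 ht'.le)
  linarith

/-- The truncated resolvent `∫₀¹ e^{-t} T_t f dt` lies in the domain, and `1 - A` sends it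
to `f - e^{-1} T_1 f`. -/
lemma exists_sub_generator_eq_sub (f : C(unitInterval, ℝ)) :
    ∃ g ∈ F.domain, g - F.generator g = f - Real.exp (-1) • F.T 1 f := by
  set u : ℝ → C(unitInterval, ℝ) := fun t => Real.exp (-t) • F.T t.toNNReal f with hu
  have hcu : Continuous u := by
    have := (F.continuous_orbit f).comp continuous_real_toNNReal
    exact (Real.continuous_exp.comp continuous_neg).smul this
  have hint : ∀ a b : ℝ, IntervalIntegrable u volume a b := fun a b => hcu.intervalIntegrable a b
  set J := ∫ t in (0 : ℝ)..1, u t with hJ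
  -- The orbit of `J` is `r ↦ e^r ∫_r^{r+1} u`, which is differentiable at `0`.
  have horb : ∀ r : ℝ≥0, F.T r J = Real.exp r • ∫ t in (r : ℝ)..(r + 1), u t := by
    intro r
    rw [hJ, ← ContinuousLinearMap.intervalIntegral_comp_comm _ (hint 0 1)]
    have : ∫ t in (r : ℝ)..(r + 1), u t = ∫ t in (0 : ℝ)..1, u (r + t) := by
      rw [intervalIntegral.integral_comp_add_left]
      simp
    rw [this, ← intervalIntegral.integral_smul]
    refine intervalIntegral.integral_congr fun t ht => ?_
    rw [uIcc_of_le zero_le_one] at ht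
    simp only [hu, map_smul, smul_smul, ← Real.exp_add]
    have hrt : ((r : ℝ) + t).toNNReal = r + t.toNNReal := by
      rw [Real.toNNReal_add r.coe_nonneg ht.1, Real.toNNReal_coe]
    rw [hrt, F.map_add, ContinuousLinearMap.comp_apply]
    congr 2
    ring
  have hder : HasDerivAt (fun r : ℝ => Real.exp r • ∫ t in r..(r + 1), u t)
      (J - (f - Real.exp (-1) • F.T 1 f)) 0 := by
    have hU : ∀ x, HasDerivAt (fun r : ℝ => ∫ t in (0 : ℝ)..r, u t) (u x) x := fun x =>
      intervalIntegral.integral_hasDerivAt_right (hint _ _)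
        (hcu.stronglyMeasurableAtFilter _ _) hcu.continuousAt
    have h1 : HasDerivAt (fun r : ℝ => ∫ t in (0 : ℝ)..(r + 1), u t) (u (0 + 1)) 0 :=
      (hU (0 + 1)).comp_add_const 0 1
    have h2 : HasDerivAt (fun r : ℝ => ∫ t in r..(r + 1), u t) (u (0 + 1) - u 0) 0 := by
      refine (h1.sub (hU 0)).congr_of_eventuallyEq (Eventually.of_forall fun r => ?_)
      simp only [Pi.sub_apply]
      rw [intervalIntegral.integral_interval_sub_left (hint _ _) (hint _ _)]
    have h3 := (Real.hasDerivAt_exp 0).smul h2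
    refine h3.congr_deriv ?_
    have e0 : u 0 = f := by simp [hu, F.map_zero]
    have e1 : u (0 + 1) = Real.exp (-1) • F.T 1 f := by simp [hu]
    rw [e0, e1]
    simp only [Real.exp_zero, one_smul, zero_add, ← hJ]
    abel
  have hlim : Tendsto (F.quotient J) (𝓝[>] 0) (𝓝 (J - (f - Real.exp (-1) • F.T 1 f))) := by
    have hcoe : Tendsto (fun r : ℝ≥0 => (r : ℝ)) (𝓝[>] 0) (𝓝[≠] 0) := by
      refine tendsto_nhdsWithin_iff.2 ⟨?_, ?_⟩
      · exact (NNReal.continuous_coe.tendsto 0).mono_left nhdsWithin_le_nhds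
      · filter_upwards [self_mem_nhdsWithin] with r hr
        exact (NNReal.coe_pos.2 hr).ne'
    refine ((hasDerivAt_iff_tendsto_slope.1 hder).comp hcoe).congr fun r => ?_
    simp [slope, quotient, horb, ← hJ]
  refine ⟨J, ⟨_, hlim⟩, ?_⟩
  rw [F.generator_eq_of_tendsto hlim]
  abel

/-- `1 - A` maps the domain of the generator onto `C([0,1])`. -/
lemma exists_sub_generator_eq (h : C(unitInterval, ℝ)) :
    ∃ g ∈ F.domain, g - F.generator g = h := by
  -- `e^{-1} T_1` is a strict contraction, so `1 - e^{-1} T_1` is invertible.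
  set K : C(unitInterval, ℝ) →L[ℝ] C(unitInterval, ℝ) := Real.exp (-1) • F.T 1 with hK
  have hK1 : ‖K‖ < 1 := by
    refine (ContinuousLinearMap.opNorm_le_bound K (Real.exp_pos (-1)).le fun f => ?_).trans_lt
      (Real.exp_lt_one_iff.2 (by norm_num))
    rw [hK, _root_.smul_apply, norm_smul, Real.norm_of_nonneg (Real.exp_pos _).le]
    exact mul_le_mul_of_nonneg_left (F.norm_T_apply_le 1 f) (Real.exp_pos _).le
  obtain ⟨g, hg, hgf⟩ := F.exists_sub_generator_eq_sub ((↑(Units.oneSub K hK1)⁻¹ :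
    C(unitInterval, ℝ) →L[ℝ] C(unitInterval, ℝ)) h)
  refine ⟨g, hg, hgf.trans ?_⟩
  have := congrArg (fun L : C(unitInterval, ℝ) →L[ℝ] C(unitInterval, ℝ) => L h)
    (Units.oneSub K hK1).mul_inv
  simpa [hK] using this

end FellerSemigroup

/-! ### Functions on the unit interval -/

lemma onReal_coe (f : unitInterval → ℝ) (x : unitInterval) : onReal f x = f x :=
  IccExtend_val _ _ _

lemma onReal_of_mem (f : unitInterval → ℝ) {x : ℝ} (hx : x ∈ Icc (0 : ℝ) 1) :
    onReal f x = f ⟨x, hx⟩ :=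
  IccExtend_of_mem _ _ hx

lemma continuous_onReal (f : C(unitInterval, ℝ)) : Continuous (onReal f) :=
  f.continuous.Icc_extend'

lemma abs_onReal_le (f : C(unitInterval, ℝ)) (x : ℝ) : |onReal f x| ≤ ‖f‖ :=
  f.norm_coe_le_norm (projIcc 0 1 zero_le_one x)

/-- Continuous functions on `[0,1]` agreeing in the interior are equal. -/
lemma eq_of_onReal_eq_on_Ioo {f g : C(unitInterval, ℝ)}
    (h : ∀ x ∈ Ioo (0 : ℝ) 1, onReal f x = onReal g x) : f = g := by
  ext x
  have := Set.EqOn.closure (s := Ioo (0 : ℝ) 1) h (continuous_onReal f) (continuous_onReal g)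
  rw [closure_Ioo zero_ne_one] at this
  rw [← onReal_coe f, ← onReal_coe g, this x.2]

/-! ### Calculus on the open unit interval -/

lemma intervalIntegrable_of_continuousOn_Ioo {φ : ℝ → ℝ} (hφ : ContinuousOn φ (Ioo 0 1)) {c x : ℝ}
    (hc : c ∈ Ioo (0 : ℝ) 1) (hx : x ∈ Ioo (0 : ℝ) 1) : IntervalIntegrable φ volume c x :=
  (hφ.mono (ordConnected_Ioo.uIcc_subset hc hx)).intervalIntegrable

lemma hasDerivAt_integral_of_continuousOn_Ioo {φ : ℝ → ℝ} (hφ : ContinuousOn φ (Ioo 0 1)) {c x : ℝ}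
    (hi : IntervalIntegrable φ volume c x) (hx : x ∈ Ioo (0 : ℝ) 1) :
    HasDerivAt (fun y => ∫ t in c..y, φ t) (φ x) x :=
  intervalIntegral.integral_hasDerivAt_right hi
    (hφ.stronglyMeasurableAtFilter isOpen_Ioo x hx) (hφ.continuousAt (isOpen_Ioo.mem_nhds hx))

lemma continuous_mul_of_tsupport_subset {v w : ℝ → ℝ} (hv : Continuous v)
    (hvs : tsupport v ⊆ Ioo 0 1) (hw : ContinuousOn w (Ioo 0 1)) :
    Continuous fun x => v x * w x := by
  refine (hv.continuousOn.mul hw).continuous_of_tsupport_subset isOpen_Ioo ?_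
  exact (tsupport_mul_subset_left (f := v) (g := w)).trans hvs

lemma strictMonoOn_Ioo_of_hasDerivAt_pos {F φ : ℝ → ℝ}
    (hF : ∀ x ∈ Ioo (0 : ℝ) 1, HasDerivAt F (φ x) x) (hφ : ∀ x ∈ Ioo (0 : ℝ) 1, 0 < φ x) :
    StrictMonoOn F (Ioo 0 1) := by
  refine strictMonoOn_of_deriv_pos (convex_Ioo 0 1)
    (fun x hx => (hF x hx).continuousAt.continuousWithinAt) fun x hx => ?_
  rw [interior_Ioo] at hx
  rw [(hF x hx).deriv]
  exact hφ x hx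

lemma tendsto_nhdsGT_of_continuous_tsupport {u : ℝ → ℝ} (hu : Continuous u)
    (hus : tsupport u ⊆ Ioo 0 1) : Tendsto u (𝓝[>] 0) (𝓝 0) := by
  have : u 0 = 0 := image_eq_zero_of_notMem_tsupport fun h => (hus h).1.ne rfl
  simpa [this] using (hu.tendsto 0).mono_left (nhdsWithin_le_nhds (s := Ioi 0))

lemma tendsto_nhdsLT_of_continuous_tsupport {u : ℝ → ℝ} (hu : Continuous u)
    (hus : tsupport u ⊆ Ioo 0 1) : Tendsto u (𝓝[<] 1) (𝓝 0) := by
  have : u 1 = 0 := image_eq_zero_of_notMem_tsupport fun h => (hus h).2.ne rfl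
  simpa [this] using (hu.tendsto 1).mono_left (nhdsWithin_le_nhds (s := Iio 1))

/-- The equation `½ b d'' + a d' = d`, written as the system `d' = s w`, `w' = 2 m d`, has no
nonzero bounded solution whose derivative `w` with respect to the scale vanishes at both ends:
`d w` is nondecreasing, because `(d w)' = s w² + 2 m d²`, and vanishes at both ends. -/
lemma eq_zero_of_reflecting {s m d w : ℝ → ℝ} {B : ℝ}
    (hs : ∀ x ∈ Ioo (0 : ℝ) 1, 0 < s x) (hm : ∀ x ∈ Ioo (0 : ℝ) 1, 0 < m x)
    (hd : ∀ x ∈ Ioo (0 : ℝ) 1, HasDerivAt d (s x * w x) x)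
    (hw : ∀ x ∈ Ioo (0 : ℝ) 1, HasDerivAt w (2 * m x * d x) x)
    (hB : ∀ x, |d x| ≤ B) (h0 : Tendsto w (𝓝[>] 0) (𝓝 0)) (h1 : Tendsto w (𝓝[<] 1) (𝓝 0)) :
    ∀ x ∈ Ioo (0 : ℝ) 1, d x = 0 := by
  have hder : ∀ x ∈ Ioo (0 : ℝ) 1,
      HasDerivAt (fun y => d y * w y) (s x * w x ^ 2 + 2 * m x * d x ^ 2) x := fun x hx =>
    ((hd x hx).mul (hw x hx)).congr_deriv (by ring)
  have hmono : MonotoneOn (fun y => d y * w y) (Ioo 0 1) := by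
    refine monotoneOn_of_deriv_nonneg (convex_Ioo 0 1)
      (fun x hx => (hder x hx).continuousAt.continuousWithinAt) ?_ ?_ <;> rw [interior_Ioo]
    · exact fun x hx => (hder x hx).differentiableAt.differentiableWithinAt
    · intro x hx
      rw [(hder x hx).deriv]
      have := hs x hx
      have := hm x hx
      positivity
  have hlim : ∀ l : Filter ℝ, Tendsto w l (𝓝 0) → Tendsto (fun y => d y * w y) l (𝓝 0) := by
    intro l hl
    refine squeeze_zero_norm (a := fun y => B * |w y|) (fun y => ?_)
      (by simpa using hl.abs.const_mul B)
    rw [norm_mul, Real.norm_eq_abs, Real.norm_eq_abs]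
    exact mul_le_mul_of_nonneg_right (hB y) (abs_nonneg _)
  have hzero : ∀ x ∈ Ioo (0 : ℝ) 1, d x * w x = 0 := by
    intro x hx
    refine le_antisymm ?_ ?_
    · refine ge_of_tendsto (hlim _ h1) ?_
      filter_upwards [Ioo_mem_nhdsLT hx.2] with y hy
      exact hmono hx ⟨hx.1.trans hy.1, hy.2⟩ hy.1.le
    · refine le_of_tendsto (hlim _ h0) ?_
      filter_upwards [Ioo_mem_nhdsGT hx.1] with y hy
      exact hmono ⟨hy.1, hy.2.trans hx.2⟩ hx hy.2.le
  intro x hx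
  have h : HasDerivAt (fun y => d y * w y) 0 x := by
    refine (hasDerivAt_const x (0 : ℝ)).congr_of_eventuallyEq ?_
    filter_upwards [isOpen_Ioo.mem_nhds hx] with y hy using hzero y hy
  have heq := (hder x hx).unique h
  have h1 : 0 ≤ s x * w x ^ 2 := mul_nonneg (hs x hx).le (sq_nonneg _)
  have h2 : 2 * m x * d x ^ 2 = 0 :=
    le_antisymm (by linarith) (mul_nonneg (mul_nonneg zero_le_two (hm x hx).le) (sq_nonneg _))
  simpa [(hm x hx).ne'] using h2

/-! ### Scale function, speed measure and the domain of the generator -/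

namespace Diffusion

variable {Ω : Type*} [MeasurableSpace Ω] (D : Diffusion Ω)

lemma s_pos (x : ℝ) : 0 < D.s x := Real.exp_pos _

lemma hasDerivAt_s {x : ℝ} (hx : x ∈ Ioo (0 : ℝ) 1) :
    HasDerivAt D.s (-(2 * D.a x / D.b x) * D.s x) x := by
  have hc : ContinuousOn (fun y => 2 * D.a y / D.b y) (Ioo 0 1) :=
    (D.continuousOn_a.const_mul 2).div D.continuousOn_b fun y hy => (D.b_pos y hy).ne'
  have h := (hasDerivAt_integral_of_continuousOn_Ioo hc (c := 1 / 2)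
    (intervalIntegrable_of_continuousOn_Ioo hc (by norm_num) hx) hx).neg.exp
  exact h.congr_deriv (mul_comm _ _)

lemma continuousOn_s : ContinuousOn D.s (Ioo 0 1) := fun _ hx =>
  (D.hasDerivAt_s hx).continuousAt.continuousWithinAt

lemma m_pos {x : ℝ} (hx : x ∈ Ioo (0 : ℝ) 1) : 0 < D.m x :=
  inv_pos.2 (mul_pos (D.s_pos x) (D.b_pos x hx))

lemma continuousOn_m : ContinuousOn D.m (Ioo 0 1) :=
  (D.continuousOn_s.mul D.continuousOn_b).inv₀ fun x hx =>
    (mul_pos (D.s_pos x) (D.b_pos x hx)).ne'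

lemma hasDerivAt_S {x : ℝ} (hx : x ∈ Ioo (0 : ℝ) 1) : HasDerivAt D.S (D.s x) x :=
  hasDerivAt_integral_of_continuousOn_Ioo D.continuousOn_s
    (intervalIntegrable_of_continuousOn_Ioo D.continuousOn_s (by norm_num) hx) hx

lemma hasDerivAt_M {x : ℝ} (hx : x ∈ Ioo (0 : ℝ) 1) : HasDerivAt D.M (D.m x) x :=
  hasDerivAt_integral_of_continuousOn_Ioo D.continuousOn_m
    (intervalIntegrable_of_continuousOn_Ioo D.continuousOn_m (by norm_num) hx) hx

lemma strictMonoOn_S : StrictMonoOn D.S (Ioo 0 1) :=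
  strictMonoOn_Ioo_of_hasDerivAt_pos (fun _ => D.hasDerivAt_S) fun x _ => D.s_pos x

lemma strictMonoOn_M : StrictMonoOn D.M (Ioo 0 1) :=
  strictMonoOn_Ioo_of_hasDerivAt_pos (fun _ => D.hasDerivAt_M) fun _ => D.m_pos

variable {D}

lemma hasDerivAt_of_mem_domain {f : C(unitInterval, ℝ)} (hf : f ∈ D.domain) {x : ℝ}
    (hx : x ∈ Ioo (0 : ℝ) 1) : HasDerivAt (onReal f) (deriv (onReal f) x) x :=
  (((D.contDiffOn_of_mem_domain f hf).contDiffAt (isOpen_Ioo.mem_nhds hx)).differentiableAt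
    two_ne_zero).hasDerivAt

lemma hasDerivAt_deriv_of_mem_domain {f : C(unitInterval, ℝ)} (hf : f ∈ D.domain) {x : ℝ}
    (hx : x ∈ Ioo (0 : ℝ) 1) :
    HasDerivAt (deriv (onReal f)) (deriv (deriv (onReal f)) x) x := by
  have h := (D.contDiffOn_of_mem_domain f hf).deriv_of_isOpen (m := 1) isOpen_Ioo
    (by norm_num [one_add_one_eq_two])
  exact ((h.contDiffAt (isOpen_Ioo.mem_nhds hx)).differentiableAt one_ne_zero).hasDerivAt

lemma onReal_generator {f : C(unitInterval, ℝ)} (hf : f ∈ D.domain) {x : ℝ}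
    (hx : x ∈ Ioo (0 : ℝ) 1) :
    onReal (D.generator f) x =
      1 / 2 * D.b x * deriv (deriv (onReal f)) x + D.a x * deriv (onReal f) x := by
  rw [onReal_of_mem _ (Ioo_subset_Icc_self hx)]
  exact D.generator_eq f hf ⟨x, Ioo_subset_Icc_self hx⟩ hx

/-- The generator in terms of scale and speed: `(f' / s)' = 2 m A f`. -/
lemma hasDerivAt_deriv_div_s {f : C(unitInterval, ℝ)} (hf : f ∈ D.domain) {x : ℝ}
    (hx : x ∈ Ioo (0 : ℝ) 1) :
    HasDerivAt (fun y => deriv (onReal f) y / D.s y)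
      (2 * D.m x * onReal (D.generator f) x) x := by
  refine ((hasDerivAt_deriv_of_mem_domain hf hx).div (D.hasDerivAt_s hx)
    (D.s_pos x).ne').congr_deriv ?_
  have hs := (D.s_pos x).ne'
  have hb := (D.b_pos x hx).ne'
  rw [onReal_generator hf hx, m]
  field_simp
  ring

/-- If both endpoints are reflecting, the domain of the generator consists of all solutions
of `(f' / s)' = 2 m h` with `h` continuous on `[0,1]` and `f' / s → 0` at both ends. -/
lemma mem_domain_of_hasDerivAt (h₀ : D.IsReflectingAtZero) (h₁ : D.IsReflectingAtOne)
    {f h : C(unitInterval, ℝ)} {u : ℝ → ℝ}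
    (hf : ∀ x ∈ Ioo (0 : ℝ) 1, HasDerivAt (onReal f) (D.s x * u x) x)
    (hu : ∀ x ∈ Ioo (0 : ℝ) 1, HasDerivAt u (2 * D.m x * onReal h x) x)
    (hu0 : Tendsto u (𝓝[>] 0) (𝓝 0)) (hu1 : Tendsto u (𝓝[<] 1) (𝓝 0)) : f ∈ D.domain := by
  obtain ⟨g, hg, hgf⟩ := D.exists_sub_generator_eq (f - h)
  have hgf' : ∀ x, onReal (D.generator g) x = onReal g x - onReal f x + onReal h x := by
    intro x
    have := congrArg (fun k : C(unitInterval, ℝ) => k (projIcc 0 1 zero_le_one x)) hgf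
    simp only [ContinuousMap.sub_apply] at this
    simp only [onReal, IccExtend_apply]
    simp only [projIcc] at this
    linarith
  have key := eq_zero_of_reflecting (s := D.s) (m := D.m) (d := fun x => onReal g x - onReal f x)
    (w := fun x => deriv (onReal g) x / D.s x - u x) (B := ‖g‖ + ‖f‖)
    (fun x _ => D.s_pos x) (fun x hx => D.m_pos hx)
    (fun x hx => ((hasDerivAt_of_mem_domain hg hx).sub (hf x hx)).congr_deriv (by
      have := (D.s_pos x).ne'
      field_simp))
    (fun x hx => ((hasDerivAt_deriv_div_s hg hx).sub (hu x hx)).congr_deriv (by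
      rw [hgf']
      ring))
    (fun x => (abs_sub _ _).trans (add_le_add (abs_onReal_le g x) (abs_onReal_le f x)))
    (by simpa using (h₀.2 g hg).sub hu0) (by simpa using (h₁.2 g hg).sub hu1)
  have : g = f := eq_of_onReal_eq_on_Ioo fun x hx => sub_eq_zero.1 (key x hx)
  exact this ▸ hg

/-- If both endpoints are reflecting, every compactly supported `C¹` function `u` is the
derivative with respect to the scale of some `f` in the domain of the generator. -/
lemma exists_mem_domain_hasDerivAt (h₀ : D.IsReflectingAtZero) (h₁ : D.IsReflectingAtOne)
    {u : ℝ → ℝ} (hu : ContDiff ℝ 1 u) (hus : tsupport u ⊆ Ioo 0 1) :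
    ∃ f ∈ D.domain, ∀ x ∈ Ioo (0 : ℝ) 1, HasDerivAt (onReal f) (D.s x * u x) x := by
  have hcs : Continuous fun x => u x * D.s x :=
    continuous_mul_of_tsupport_subset hu.continuous hus D.continuousOn_s
  have hch : Continuous fun x => deriv u x * (D.s x * D.b x / 2) :=
    continuous_mul_of_tsupport_subset (hu.continuous_deriv le_rfl)
      ((closure_minimal (support_deriv_subset (f := u)) (isClosed_tsupport u)).trans hus)
      ((D.continuousOn_s.mul D.continuousOn_b).div_const 2)
  let f : C(unitInterval, ℝ) := ⟨fun x => ∫ t in (0 : ℝ)..x, u t * D.s t,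
    (intervalIntegral.continuous_primitive (fun _ _ => hcs.intervalIntegrable _ _) 0).comp
      continuous_subtype_val⟩
  let h : C(unitInterval, ℝ) := ⟨fun x => deriv u x * (D.s x * D.b x / 2),
    hch.comp continuous_subtype_val⟩
  have hf : ∀ x ∈ Ioo (0 : ℝ) 1, HasDerivAt (onReal f) (D.s x * u x) x := by
    intro x hx
    have h1 : HasDerivAt (fun y => ∫ t in (0 : ℝ)..y, u t * D.s t) (u x * D.s x) x :=
      intervalIntegral.integral_hasDerivAt_right (hcs.intervalIntegrable _ _)
        (hcs.stronglyMeasurableAtFilter _ _) hcs.continuousAt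
    rw [mul_comm]
    refine h1.congr_of_eventuallyEq ?_
    filter_upwards [isOpen_Ioo.mem_nhds hx] with y hy
    rw [onReal_of_mem _ (Ioo_subset_Icc_self hy)]
    rfl
  refine ⟨f, mem_domain_of_hasDerivAt h₀ h₁ (h := h) (u := u) hf (fun x hx => ?_)
    (tendsto_nhdsGT_of_continuous_tsupport hu.continuous hus)
    (tendsto_nhdsLT_of_continuous_tsupport hu.continuous hus), hf⟩
  refine (hu.differentiable one_ne_zero x).hasDerivAt.congr_deriv ?_
  rw [onReal_of_mem _ (Ioo_subset_Icc_self hx)]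
  change _ = 2 * D.m x * (deriv u x * (D.s x * D.b x / 2))
  have hs := (D.s_pos x).ne'
  have hb := (D.b_pos x hx).ne'
  rw [m]
  field_simp

end Diffusion

/-! ### Integrability of the scale and speed densities at regular endpoints -/

lemma integrableOn_of_lintegral_weight_lt_top {φ w : ℝ → ℝ} {A : Set ℝ} {δ : ℝ}
    (hA : MeasurableSet A) (hφc : ContinuousOn φ A) (hφ : ∀ x ∈ A, 0 ≤ φ x) (hδ : 0 < δ)
    (hw : ∀ x ∈ A, δ ≤ w x) (h : ∫⁻ x in A, ENNReal.ofReal (w x * φ x) < ∞) :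
    IntegrableOn φ A := by
  refine ⟨hφc.aestronglyMeasurable hA, ?_⟩
  have h1 : ∫⁻ x in A, ‖φ x‖ₑ ≤
      ∫⁻ x in A, ENNReal.ofReal δ⁻¹ * ENNReal.ofReal (w x * φ x) := by
    refine setLIntegral_mono' hA fun x hx => ?_
    rw [Real.enorm_of_nonneg (hφ x hx), ← ENNReal.ofReal_mul (inv_nonneg.2 hδ.le)]
    refine ENNReal.ofReal_le_ofReal ?_
    rw [le_inv_mul_iff₀ hδ]
    exact mul_le_mul_of_nonneg_right (hw x hx) (hφ x hx)
  rw [lintegral_const_mul' _ _ ENNReal.ofReal_ne_top] at h1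
  exact h1.trans_lt (ENNReal.mul_lt_top ENNReal.ofReal_lt_top h)

/-- A density is integrable as soon as its integrals against increments of a strictly increasing
function `F` are finite at both ends: away from the base point these increments are bounded
below. -/
lemma integrableOn_of_lintegral_increment_lt_top {φ F : ℝ → ℝ} (hφc : ContinuousOn φ (Ioo 0 1))
    (hφ : ∀ x ∈ Ioo (0 : ℝ) 1, 0 ≤ φ x) (hF : StrictMonoOn F (Ioo 0 1))
    (h0 : ∫⁻ η in Ioc 0 (3 / 4), ENNReal.ofReal ((F (3 / 4) - F η) * φ η) < ∞)
    (h1 : ∫⁻ η in Ico (1 / 4) 1, ENNReal.ofReal ((F η - F (1 / 4)) * φ η) < ∞) :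
    IntegrableOn φ (Ioo 0 1) := by
  have hl : IntegrableOn φ (Ioc 0 (1 / 2)) := by
    have hsub : Ioc (0 : ℝ) (1 / 2) ⊆ Ioo 0 1 := fun x hx => ⟨hx.1, by linarith [hx.2]⟩
    refine integrableOn_of_lintegral_weight_lt_top (δ := F (3 / 4) - F (1 / 2))
      measurableSet_Ioc (hφc.mono hsub) (fun x hx => hφ x (hsub hx))
      (sub_pos.2 (hF (by norm_num) (by norm_num) (by norm_num))) (fun x hx => ?_)
      ((lintegral_mono_set (Ioc_subset_Ioc_right (by norm_num))).trans_lt h0)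
    have := hF.monotoneOn (hsub hx) (by norm_num) hx.2
    linarith
  have hr : IntegrableOn φ (Ico (1 / 2) 1) := by
    have hsub : Ico (1 / 2 : ℝ) 1 ⊆ Ioo 0 1 := fun x hx => ⟨by linarith [hx.1], hx.2⟩
    refine integrableOn_of_lintegral_weight_lt_top (δ := F (1 / 2) - F (1 / 4))
      measurableSet_Ico (hφc.mono hsub) (fun x hx => hφ x (hsub hx))
      (sub_pos.2 (hF (by norm_num) (by norm_num) (by norm_num))) (fun x hx => ?_)
      ((lintegral_mono_set (Ico_subset_Ico_left (by norm_num))).trans_lt h1)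
    have := hF.monotoneOn (by norm_num) (hsub hx) hx.1
    linarith
  refine (hl.union hr).mono_set fun x hx => ?_
  rcases le_total x (1 / 2) with h | h
  · exact Or.inl ⟨hx.1, h⟩
  · exact Or.inr ⟨h, hx.2⟩

namespace Diffusion

variable {Ω : Type*} [MeasurableSpace Ω] {D : Diffusion Ω}

lemma integrableOn_m (h₀ : D.IsRegularAtZero) (h₁ : D.IsRegularAtOne) :
    IntegrableOn D.m (Ioo 0 1) :=
  integrableOn_of_lintegral_increment_lt_top D.continuousOn_m (fun _ hx => (D.m_pos hx).le)
    D.strictMonoOn_S (h₀ (3 / 4) (by norm_num)).1 (h₁ (1 / 4) (by norm_num)).1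

lemma integrableOn_s (h₀ : D.IsRegularAtZero) (h₁ : D.IsRegularAtOne) :
    IntegrableOn D.s (Ioo 0 1) :=
  integrableOn_of_lintegral_increment_lt_top D.continuousOn_s (fun x _ => (D.s_pos x).le)
    D.strictMonoOn_M (h₀ (3 / 4) (by norm_num)).2 (h₁ (1 / 4) (by norm_num)).2

/-! ### The stationary distribution -/

variable (D) in
/-- The total mass of the speed measure. -/
def mass : ℝ := ∫ y in Ioo (0 : ℝ) 1, D.m y

lemma statDensity_eq (x : ℝ) : D.statDensity x = D.m x / D.mass := rfl

lemma continuousOn_statDensity : ContinuousOn D.statDensity (Ioo 0 1) :=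
  D.continuousOn_m.div_const _

section

variable (hm : IntegrableOn D.m (Ioo 0 1))
include hm

lemma mass_pos : 0 < D.mass := by
  refine (setIntegral_pos_iff_support_of_nonneg_ae ?_ hm).2 ?_
  · exact (ae_restrict_iff' measurableSet_Ioo).2 (ae_of_all _ fun x hx => (D.m_pos hx).le)
  · have : Ioo (0 : ℝ) 1 ⊆ Function.support D.m ∩ Ioo 0 1 := fun x hx => ⟨(D.m_pos hx).ne', hx⟩
    exact (by simp : (0 : ℝ≥0∞) < volume (Ioo (0 : ℝ) 1)).trans_le (measure_mono this)

lemma statDensity_pos {x : ℝ} (hx : x ∈ Ioo (0 : ℝ) 1) : 0 < D.statDensity x :=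
  div_pos (D.m_pos hx) (mass_pos hm)

lemma intervalIntegrable_statDensity {x y : ℝ} (hx : x ∈ Icc (0 : ℝ) 1) (hy : y ∈ Icc (0 : ℝ) 1) :
    IntervalIntegrable D.statDensity volume x y := by
  have h : IntervalIntegrable D.statDensity volume 0 1 :=
    (intervalIntegrable_iff_integrableOn_Ioo_of_le zero_le_one).2 (hm.div_const _)
  exact h.mono_set (by
    rw [uIcc_of_le zero_le_one]
    exact ordConnected_Icc.uIcc_subset hx hy)

lemma hasDerivAt_statCDF {x : ℝ} (hx : x ∈ Ioo (0 : ℝ) 1) :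
    HasDerivAt D.statCDF (D.statDensity x) x :=
  hasDerivAt_integral_of_continuousOn_Ioo continuousOn_statDensity
    (intervalIntegrable_statDensity hm (by simp) (Ioo_subset_Icc_self hx)) hx

lemma statCDF_pos {x : ℝ} (hx : x ∈ Ioc (0 : ℝ) 1) : 0 < D.statCDF x :=
  intervalIntegral.intervalIntegral_pos_of_pos_on
    (intervalIntegrable_statDensity hm (by simp) ⟨hx.1.le, hx.2⟩)
    (fun _ hy => statDensity_pos hm ⟨hy.1, hy.2.trans_le hx.2⟩) hx.1

lemma statCDF_mono {x y : ℝ} (hx : 0 ≤ x) (hxy : x ≤ y) (hy : y ≤ 1) :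
    D.statCDF x ≤ D.statCDF y := by
  have h := intervalIntegral.integral_add_adjacent_intervals
    (intervalIntegrable_statDensity hm (x := 0) (by simp) ⟨hx, hxy.trans hy⟩)
    (intervalIntegrable_statDensity hm ⟨hx, hxy.trans hy⟩ ⟨hx.trans hxy, hy⟩)
  have h2 : 0 ≤ ∫ t in x..y, D.statDensity t := by
    rw [intervalIntegral.integral_of_le hxy, integral_Ioc_eq_integral_Ioo]
    exact setIntegral_nonneg measurableSet_Ioo fun t ht =>
      (statDensity_pos hm ⟨hx.trans_lt ht.1, ht.2.trans_le hy⟩).le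
  unfold statCDF
  linarith

lemma continuousOn_statCDF : ContinuousOn D.statCDF (Icc 0 1) := by
  have h := intervalIntegral.continuousOn_primitive_interval (f := D.statDensity) (μ := volume)
    (a := 0) (b := 1)
    (by
      rw [uIcc_of_le zero_le_one, integrableOn_Icc_iff_integrableOn_Ioo]
      exact hm.div_const _)
  rwa [uIcc_of_le zero_le_one] at h

lemma tendsto_statCDF_zero : Tendsto D.statCDF (𝓝[>] 0) (𝓝[>] 0) := by
  refine tendsto_nhdsWithin_iff.2 ⟨?_, ?_⟩
  · have h := (continuousOn_statCDF hm) 0 (by simp)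
    have h0 : D.statCDF 0 = 0 := intervalIntegral.integral_same
    rw [ContinuousWithinAt, h0] at h
    refine h.mono_left ?_
    rw [← nhdsWithin_Ioo_eq_nhdsGT zero_lt_one]
    exact nhdsWithin_mono _ Ioo_subset_Icc_self
  · filter_upwards [Ioo_mem_nhdsGT zero_lt_one] with x hx
    exact statCDF_pos hm ⟨hx.1, hx.2.le⟩

/-! ### The link operator -/

lemma intervalIntegrable_statDensity_mul (f : C(unitInterval, ℝ)) {x y : ℝ}
    (hx : x ∈ Icc (0 : ℝ) 1) (hy : y ∈ Icc (0 : ℝ) 1) :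
    IntervalIntegrable (fun t => D.statDensity t * onReal f t) volume x y :=
  (intervalIntegrable_statDensity hm hx hy).mul_continuousOn (continuous_onReal f).continuousOn

omit hm in
lemma onReal_link {f : unitInterval → ℝ} {x : ℝ} (hx : x ∈ Ioc (0 : ℝ) 1) :
    onReal (D.link f) x = (∫ y in (0 : ℝ)..x, D.statDensity y * onReal f y) / D.statCDF x := by
  rw [onReal_of_mem _ (Ioc_subset_Icc_self hx), link, if_neg]
  · rw [← intervalIntegral.integral_div]
    congr 1
    ext y
    ring
  · intro h
    exact hx.1.ne' (congrArg Subtype.val h)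

lemma link_sub (f g : C(unitInterval, ℝ)) : D.link ⇑(f - g) = D.link f - D.link g := by
  ext x
  rcases eq_or_ne x 0 with rfl | hx
  · simp [link]
  have hx' : (x : ℝ) ∈ Ioc (0 : ℝ) 1 := ⟨unitInterval.pos_iff_ne_zero.2 hx, x.2.2⟩
  rw [Pi.sub_apply, ← onReal_coe (D.link _), ← onReal_coe (D.link f), ← onReal_coe (D.link g),
    onReal_link hx', onReal_link hx', onReal_link hx', ← sub_div,
    ← intervalIntegral.integral_sub
      (intervalIntegrable_statDensity_mul hm f (by simp) x.2)
      (intervalIntegrable_statDensity_mul hm g (by simp) x.2)]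
  simp only [← mul_sub]
  rfl

lemma hasDerivAt_integral_statDensity_mul (f : C(unitInterval, ℝ)) {x : ℝ}
    (hx : x ∈ Ioo (0 : ℝ) 1) :
    HasDerivAt (fun y => ∫ t in (0 : ℝ)..y, D.statDensity t * onReal f t)
      (D.statDensity x * onReal f x) x :=
  hasDerivAt_integral_of_continuousOn_Ioo
    (continuousOn_statDensity.mul (continuous_onReal f).continuousOn)
    (intervalIntegrable_statDensity_mul hm f (by simp) (Ioo_subset_Icc_self hx)) hx

/-- `(Λ f)' = (π / Π) (f - Λ f)`. -/
lemma hasDerivAt_link (f : C(unitInterval, ℝ)) {x : ℝ} (hx : x ∈ Ioo (0 : ℝ) 1) :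
    HasDerivAt (onReal (D.link f))
      (D.statDensity x / D.statCDF x * (onReal f x - onReal (D.link f) x)) x := by
  have hP := (statCDF_pos hm ⟨hx.1, hx.2.le⟩).ne'
  have h := (hasDerivAt_integral_statDensity_mul hm f hx).div (hasDerivAt_statCDF hm hx) hP
  refine (h.congr_deriv ?_).congr_of_eventuallyEq ?_
  · rw [onReal_link ⟨hx.1, hx.2.le⟩]
    field_simp
  · filter_upwards [isOpen_Ioo.mem_nhds hx] with y hy
    exact onReal_link ⟨hy.1, hy.2.le⟩

/-- `Λ A f` is a multiple of `f' / (s Π)`. -/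
lemma integral_statDensity_mul_generator {f : C(unitInterval, ℝ)} (hf : f ∈ D.domain) {x l : ℝ}
    (hx : x ∈ Ioc (0 : ℝ) 1)
    (h0 : Tendsto (fun y => deriv (onReal f) y / D.s y) (𝓝[>] 0) (𝓝 0))
    (hl : Tendsto (fun y => deriv (onReal f) y / D.s y) (𝓝[<] x) (𝓝 l)) :
    ∫ y in (0 : ℝ)..x, D.statDensity y * onReal (D.generator f) y = l / (2 * D.mass) := by
  have hc := (mass_pos hm).ne'
  have h := intervalIntegral.integral_eq_sub_of_hasDerivAt_of_tendsto
    (f := fun y => deriv (onReal f) y / D.s y / (2 * D.mass))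
    (f' := fun y => D.statDensity y * onReal (D.generator f) y) hx.1
    (fun y hy => ((hasDerivAt_deriv_div_s hf ⟨hy.1, hy.2.trans_le hx.2⟩).div_const _).congr_deriv
      (by
        rw [statDensity_eq]
        field_simp))
    (intervalIntegrable_statDensity_mul hm _ (by simp) ⟨hx.1.le, hx.2⟩)
    (by simpa using h0.div_const (2 * D.mass)) (hl.div_const _)
  simpa using h

end

end Diffusion

namespace Diffusion

variable {Ω Ω' : Type*} [MeasurableSpace Ω] [MeasurableSpace Ω'] {D : Diffusion Ω}
  {D' : Diffusion Ω'}

/-! ### The coefficients of the dual -/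

lemma hasDerivAt_statDensity (hb : ContDiffOn ℝ 1 D.b (Ioo 0 1)) {x : ℝ}
    (hx : x ∈ Ioo (0 : ℝ) 1) :
    HasDerivAt D.statDensity
      (D.statDensity x * (2 * D.a x / D.b x - deriv D.b x / D.b x)) x := by
  have hb' : HasDerivAt D.b (deriv D.b x) x :=
    ((hb.contDiffAt (isOpen_Ioo.mem_nhds hx)).differentiableAt one_ne_zero).hasDerivAt
  have hs := (D.s_pos x).ne'
  have hbx := (D.b_pos x hx).ne'
  refine ((((D.hasDerivAt_s hx).mul hb').inv (mul_ne_zero hs hbx)).div_const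
    D.mass).congr_deriv ?_
  simp only [statDensity_eq, m, Pi.mul_apply]
  field_simp
  ring

/-- The intertwining `A* Λ f = Λ A f`, evaluated at an interior point in terms of `f'` and
`f - Λ f`. -/
lemma coefficient_relation (hm : IntegrableOn D.m (Ioo 0 1)) (h₀ : D.IsReflectingAtZero)
    (hb : ContDiffOn ℝ 1 D.b (Ioo 0 1)) {f g : C(unitInterval, ℝ)} (hf : f ∈ D.domain)
    (hg : g ∈ D'.domain) (hgf : ⇑g = D.link f)
    (hgen : ⇑(D'.generator g) = D.link (D.generator f)) {x : ℝ} (hx : x ∈ Ioo (0 : ℝ) 1) :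
    1 / 2 * (D'.b x - D.b x) * deriv (onReal f) x +
      (D'.a x + 1 / 2 * D'.b x * (2 * D.a x / D.b x - deriv D.b x / D.b x -
        2 * (D.statDensity x / D.statCDF x))) * (onReal f x - onReal g x) = 0 := by
  have hP := (statCDF_pos hm ⟨hx.1, hx.2.le⟩)
  have hp := statDensity_pos hm hx
  have hc := mass_pos hm
  have hs := D.s_pos x
  have hbx := D.b_pos x hx
  have hg1 : ∀ y ∈ Ioo (0 : ℝ) 1, deriv (onReal g) y =
      D.statDensity y / D.statCDF y * (onReal f y - onReal g y) := by
    intro y hy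
    rw [hgf]
    exact (hasDerivAt_link hm f hy).deriv
  have hg2 : deriv (deriv (onReal g)) x = D.statDensity x / D.statCDF x *
      (2 * D.a x / D.b x - deriv D.b x / D.b x - 2 * (D.statDensity x / D.statCDF x)) *
        (onReal f x - onReal g x) + D.statDensity x / D.statCDF x * deriv (onReal f) x := by
    have h := ((hasDerivAt_statDensity hb hx).div (hasDerivAt_statCDF hm hx) hP.ne').mul
      ((hasDerivAt_of_mem_domain hf hx).sub (hasDerivAt_of_mem_domain hg hx))
    refine Eq.trans ?_ (h.deriv.trans ?_)
    · refine Filter.EventuallyEq.deriv_eq ?_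
      filter_upwards [isOpen_Ioo.mem_nhds hx] with y hy using hg1 y hy
    · simp only [Pi.div_apply, Pi.sub_apply]
      rw [hg1 x hx]
      field_simp
      ring
  have hA : onReal (D'.generator g) x =
      D.statDensity x / D.statCDF x * (1 / 2 * D.b x * deriv (onReal f) x) := by
    rw [hgen, onReal_link ⟨hx.1, hx.2.le⟩,
      integral_statDensity_mul_generator hm hf ⟨hx.1, hx.2.le⟩ (h₀.2 f hf)
        ((hasDerivAt_deriv_div_s hf hx).continuousAt.tendsto.mono_left nhdsWithin_le_nhds),
      statDensity_eq, m]
    field_simp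
  rw [onReal_generator hg hx, hg2, hg1 x hx] at hA
  have hr : D.statDensity x / D.statCDF x ≠ 0 := (div_pos hp hP).ne'
  refine mul_left_cancel₀ hr ?_
  linear_combination hA

/-- If `f` is nondecreasing, and strictly increasing at some point below `x`, then `f x` exceeds
the mean `Λ f x` of `f` over `(0, x]`. -/
lemma link_lt_of_deriv_nonneg (hm : IntegrableOn D.m (Ioo 0 1)) {f g : C(unitInterval, ℝ)}
    (hgf : ⇑g = D.link f) {v : ℝ → ℝ} (hf : ∀ x ∈ Ioo (0 : ℝ) 1, HasDerivAt (onReal f) (v x) x)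
    (hv : ∀ x ∈ Ioo (0 : ℝ) 1, 0 ≤ v x) {x y : ℝ} (hx : x < 1) (hy : 0 < y) (hyx : y < x)
    (hvy : v y ≠ 0) : onReal g x < onReal f x := by
  -- `Π (f - Λ f)` has derivative `Π f'` and vanishes at `0`.
  set h : ℝ → ℝ := fun t => D.statCDF t * (onReal f t - onReal g t) with hh
  have hder : ∀ t ∈ Ioo (0 : ℝ) 1, HasDerivAt h (D.statCDF t * v t) t := by
    intro t ht
    have hP := (statCDF_pos hm ⟨ht.1, ht.2.le⟩).ne'
    have hg := hasDerivAt_link hm f ht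
    rw [← hgf] at hg
    refine ((hasDerivAt_statCDF hm ht).mul ((hf t ht).sub hg)).congr_deriv ?_
    simp only [Pi.sub_apply]
    field_simp
    ring
  have hmono : MonotoneOn h (Ioo 0 1) := by
    refine monotoneOn_of_deriv_nonneg (convex_Ioo 0 1)
      (fun t ht => (hder t ht).continuousAt.continuousWithinAt) ?_ ?_ <;> rw [interior_Ioo]
    · exact fun t ht => (hder t ht).differentiableAt.differentiableWithinAt
    · intro t ht
      rw [(hder t ht).deriv]
      exact mul_nonneg (statCDF_pos hm ⟨ht.1, ht.2.le⟩).le (hv t ht)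
  have hlim : Tendsto h (𝓝[>] 0) (𝓝 0) := by
    have h1 := (tendsto_statCDF_zero hm).mono_right nhdsWithin_le_nhds
    have h2 := (((continuous_onReal f).sub (continuous_onReal g)).tendsto 0).mono_left
      (nhdsWithin_le_nhds (s := Ioi 0))
    simpa using h1.mul h2
  have hnn : ∀ t ∈ Ioo (0 : ℝ) 1, 0 ≤ h t := by
    intro t ht
    refine le_of_tendsto hlim ?_
    filter_upwards [Ioo_mem_nhdsGT ht.1] with z hz
    exact hmono ⟨hz.1, hz.2.trans ht.2⟩ ht hz.2.le
  have hx' : x ∈ Ioo (0 : ℝ) 1 := ⟨hy.trans hyx, hx⟩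
  have hy' : y ∈ Ioo (0 : ℝ) 1 := ⟨hy, hyx.trans hx⟩
  have hpos : 0 < h x := by
    refine lt_of_le_of_ne (hnn x hx') fun h0 => ?_
    -- Otherwise `h` vanishes on `(0, x]`, so that `v y = 0`.
    have hz : HasDerivAt h 0 y := by
      refine (hasDerivAt_const y (0 : ℝ)).congr_of_eventuallyEq ?_
      filter_upwards [isOpen_Ioo.mem_nhds (show y ∈ Ioo 0 x from ⟨hy, hyx⟩)] with z hz
      have hz' : z ∈ Ioo (0 : ℝ) 1 := ⟨hz.1, hz.2.trans hx⟩
      exact le_antisymm ((hmono hz' hx' hz.2.le).trans h0.ge) (hnn z hz')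
    have := (hder y hy').unique hz
    exact (mul_ne_zero (statCDF_pos hm ⟨hy'.1, hy'.2.le⟩).ne' hvy) this
  have := pos_of_mul_pos_right hpos (statCDF_pos hm ⟨hx'.1, hx'.2.le⟩).le
  linarith

lemma exists_bump {c r : ℝ} (hr : 0 < r) (h0 : 0 < c - r) (h1 : c + r < 1) :
    ∃ u : ℝ → ℝ, ContDiff ℝ 1 u ∧ tsupport u ⊆ Ioo 0 1 ∧ (∀ x, 0 ≤ u x) ∧
      (∀ x, r ≤ |x - c| → u x = 0) ∧ u c = 1 := by
  let φ : ContDiffBump c := ⟨r / 2, r, half_pos hr, half_lt_self hr⟩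
  refine ⟨φ, φ.contDiff, ?_, fun x => φ.nonneg, fun x hx => φ.zero_of_le_dist hx,
    φ.one_of_mem_closedBall (by simpa [φ] using (half_pos hr).le)⟩
  rw [φ.tsupport_eq, Real.closedBall_eq_Icc]
  exact Icc_subset_Ioo h0 h1

/-- The coefficients of a strong stationary dual. Test functions whose derivative with respect to
the scale is a bump separate the coefficients of `f'` and `f - Λ f` in the intertwining
relation. -/
lemma dual_coefficients (h₀ : D.IsReflectingAtZero) (h₁ : D.IsReflectingAtOne)
    (hb : ContDiffOn ℝ 1 D.b (Ioo 0 1)) (hdual : D.IsStrongStationaryDual D') {x : ℝ}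
    (hx : x ∈ Ioo (0 : ℝ) 1) :
    D'.b x = D.b x ∧ D'.a x =
      1 / 2 * deriv D.b x - D.a x + D.b x * (D.statDensity x / D.statCDF x) := by
  have hm := integrableOn_m h₀.1 h₁.1
  have hbx := D.b_pos x hx
  -- A bump to the left of `x` gives `f' x = 0` and `f x ≠ Λ f x`.
  have hC : D'.a x + 1 / 2 * D'.b x * (2 * D.a x / D.b x - deriv D.b x / D.b x -
      2 * (D.statDensity x / D.statCDF x)) = 0 := by
    obtain ⟨u, hu, hus, hu0, huz, hu1⟩ := exists_bump (c := x / 2) (r := x / 4)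
      (by linarith [hx.1]) (by linarith [hx.1]) (by linarith [hx.1, hx.2])
    obtain ⟨f, hf, hfu⟩ := exists_mem_domain_hasDerivAt h₀ h₁ hu hus
    obtain ⟨g, hg, hgf, hgen⟩ := hdual.1 f hf
    have hrel := coefficient_relation hm h₀ hb hf hg hgf hgen hx
    have hlt := link_lt_of_deriv_nonneg hm hgf hfu
      (fun t _ => mul_nonneg (D.s_pos t).le (hu0 t)) hx.2 (half_pos hx.1) (half_lt_self hx.1)
      (by rw [hu1]; exact (mul_pos (D.s_pos _) one_pos).ne')
    have hux : u x = 0 := huz x (by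
      rw [abs_of_pos (by linarith [hx.1])]
      linarith [hx.1])
    rw [(hfu x hx).deriv, hux, mul_zero, mul_zero, zero_add] at hrel
    exact (mul_eq_zero.1 hrel).resolve_right (sub_pos.2 hlt).ne'
  have hbb : D'.b x = D.b x := by
    obtain ⟨u, hu, hus, -, -, hu1⟩ := exists_bump (c := x) (r := min x (1 - x) / 2)
      (by have := lt_min hx.1 (sub_pos.2 hx.2); linarith)
      (by linarith [min_le_left x (1 - x), hx.1]) (by linarith [min_le_right x (1 - x), hx.2])
    obtain ⟨f, hf, hfu⟩ := exists_mem_domain_hasDerivAt h₀ h₁ hu hus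
    obtain ⟨g, hg, hgf, hgen⟩ := hdual.1 f hf
    have hrel := coefficient_relation hm h₀ hb hf hg hgf hgen hx
    rw [hC, zero_mul, add_zero, (hfu x hx).deriv, hu1, mul_one] at hrel
    have := (mul_eq_zero.1 hrel).resolve_right (D.s_pos x).ne'
    linarith
  refine ⟨hbb, ?_⟩
  rw [hbb] at hC
  field_simp at hC ⊢
  linarith

/-! ### The scale function and the speed measure of the dual -/

lemma eq_of_hasDerivAt_zero_on_Ioo {k : ℝ → ℝ}
    (hk : ∀ x ∈ Ioo (0 : ℝ) 1, HasDerivAt k 0 x) {x y : ℝ} (hx : x ∈ Ioo (0 : ℝ) 1)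
    (hy : y ∈ Ioo (0 : ℝ) 1) : k x = k y :=
  isOpen_Ioo.is_const_of_deriv_eq_zero isPreconnected_Ioo
    (fun z hz => (hk z hz).differentiableAt.differentiableWithinAt)
    (fun z hz => (hk z hz).deriv) hx hy

/-- The scale density of the dual is a multiple of `π / Π²`, and its speed density a multiple of
`s Π²`. -/
lemma exists_dual_s_eq (h₀ : D.IsReflectingAtZero) (h₁ : D.IsReflectingAtOne)
    (hb : ContDiffOn ℝ 1 D.b (Ioo 0 1)) (hdual : D.IsStrongStationaryDual D') :
    ∃ C > 0, ∀ x ∈ Ioo (0 : ℝ) 1, D'.s x = C * (D.statDensity x / D.statCDF x ^ 2) ∧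
      D'.m x = D.mass / C * (D.s x * D.statCDF x ^ 2) := by
  have hm := integrableOn_m h₀.1 h₁.1
  have hc := mass_pos hm
  set k : ℝ → ℝ := fun x => D'.s x * D.statCDF x ^ 2 / D.statDensity x with hk
  have hder : ∀ x ∈ Ioo (0 : ℝ) 1, HasDerivAt k 0 x := by
    intro x hx
    have hP := statCDF_pos hm ⟨hx.1, hx.2.le⟩
    have hp := statDensity_pos hm hx
    have hbx := D.b_pos x hx
    obtain ⟨hbb, haa⟩ := dual_coefficients h₀ h₁ hb hdual hx
    refine (((D'.hasDerivAt_s hx).mul ((hasDerivAt_statCDF hm hx).pow 2)).div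
      (hasDerivAt_statDensity hb hx) hp.ne').congr_deriv ?_
    simp only [Pi.mul_apply, Pi.pow_apply, hbb, haa]
    field_simp
    ring
  have hmem : (1 / 2 : ℝ) ∈ Ioo (0 : ℝ) 1 := by norm_num
  refine ⟨k (1 / 2), div_pos (mul_pos (D'.s_pos _)
    (pow_pos (statCDF_pos hm ⟨hmem.1, hmem.2.le⟩) 2)) (statDensity_pos hm hmem), fun x hx => ?_⟩
  have hP := statCDF_pos hm ⟨hx.1, hx.2.le⟩
  have hp := statDensity_pos hm hx
  have hs' : D'.s x = k (1 / 2) * (D.statDensity x / D.statCDF x ^ 2) := by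
    rw [← eq_of_hasDerivAt_zero_on_Ioo hder hx hmem, hk]
    field_simp
  refine ⟨hs', ?_⟩
  have hkx : 0 < k x := div_pos (mul_pos (D'.s_pos _) (pow_pos hP 2)) hp
  rw [m, hs', (dual_coefficients h₀ h₁ hb hdual hx).1,
    ← eq_of_hasDerivAt_zero_on_Ioo hder hx hmem, statDensity_eq, m]
  have hs := D.s_pos x
  have hbx := D.b_pos x hx
  field_simp

end Diffusion

/-! ### Boundary classification for the dual -/

lemma lintegral_ofReal_lt_top_of_le {φ g : ℝ → ℝ} {A : Set ℝ} {K : ℝ}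
    (hφ : IntegrableOn φ (Ioo 0 1)) (hA : MeasurableSet A) (hA1 : A ⊆ Ioo 0 1)
    (hg : ∀ x ∈ A, g x ≤ K * φ x) : ∫⁻ x in A, ENNReal.ofReal (g x) < ∞ :=
  (setLIntegral_mono' hA fun x hx => ENNReal.ofReal_le_ofReal (hg x hx)).trans_lt
    (((hφ.mono_set hA1).const_mul K).lintegral_lt_top)

namespace Diffusion

variable {Ω Ω' : Type*} [MeasurableSpace Ω] [MeasurableSpace Ω'] {D : Diffusion Ω}
  {D' : Diffusion Ω'}

/-- The scale function of the dual is `-C / Π`, up to an additive constant. -/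
lemma dual_S_sub (hm : IntegrableOn D.m (Ioo 0 1)) {C : ℝ}
    (hs : ∀ x ∈ Ioo (0 : ℝ) 1, D'.s x = C * (D.statDensity x / D.statCDF x ^ 2)) {x y : ℝ}
    (hx : x ∈ Ioo (0 : ℝ) 1) (hy : y ∈ Ioo (0 : ℝ) 1) :
    D'.S x - D'.S y = C * ((D.statCDF y)⁻¹ - (D.statCDF x)⁻¹) := by
  have h := eq_of_hasDerivAt_zero_on_Ioo (k := fun z => D'.S z + C * (D.statCDF z)⁻¹)
    (fun z hz => by
      have hP := (statCDF_pos hm ⟨hz.1, hz.2.le⟩).ne'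
      refine ((D'.hasDerivAt_S hz).add
        (((hasDerivAt_statCDF hm hz).inv hP).const_mul C)).congr_deriv ?_
      rw [hs z hz]
      ring) hx hy
  linarith

lemma dual_isEntranceAtZero (h₀ : D.IsReflectingAtZero) (h₁ : D.IsReflectingAtOne)
    (hb : ContDiffOn ℝ 1 D.b (Ioo 0 1)) (hdual : D.IsStrongStationaryDual D') :
    D'.IsEntranceAtZero := by
  have hm := integrableOn_m h₀.1 h₁.1
  have hc := mass_pos hm
  obtain ⟨C, hC, hCx⟩ := exists_dual_s_eq h₀ h₁ hb hdual
  have hS : ∀ {x y : ℝ}, x ∈ Ioo (0 : ℝ) 1 → y ∈ Ioo (0 : ℝ) 1 →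
      D'.S x - D'.S y = C * ((D.statCDF y)⁻¹ - (D.statCDF x)⁻¹) :=
    dual_S_sub hm fun x hx => (hCx x hx).1
  intro x hx
  constructor
  · -- `(S* x - S* η) m* η` is at most a multiple of `Π η * s η`.
    refine lintegral_ofReal_lt_top_of_le (K := D.mass * D.statCDF x)
      (integrableOn_s h₀.1 h₁.1) measurableSet_Ioc (fun η hη => ⟨hη.1, hη.2.trans_lt hx.2⟩)
      fun η hη => ?_
    have hη' : η ∈ Ioo (0 : ℝ) 1 := ⟨hη.1, hη.2.trans_lt hx.2⟩
    have hP := statCDF_pos hm ⟨hη'.1, hη'.2.le⟩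
    have hPx := statCDF_pos hm ⟨hx.1, hx.2.le⟩
    have hle := statCDF_mono hm hη.1.le hη.2 hx.2.le
    have hs := D.s_pos η
    rw [hS hx hη', (hCx η hη').2]
    calc C * ((D.statCDF η)⁻¹ - (D.statCDF x)⁻¹) *
          (D.mass / C * (D.s η * D.statCDF η ^ 2))
        ≤ C * (D.statCDF η)⁻¹ * (D.mass / C * (D.s η * D.statCDF η ^ 2)) := by
          have := inv_pos.2 hPx
          gcongr
          linarith
      _ = D.mass * D.statCDF η * D.s η := by field_simp
      _ ≤ D.mass * D.statCDF x * D.s η := by gcongr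
  · by_contra hne
    have hx2 : x / 2 ∈ Ioo (0 : ℝ) 1 := ⟨half_pos hx.1, by linarith [hx.1, hx.2]⟩
    have hsub : Ioc 0 (x / 2) ⊆ Ioo (0 : ℝ) 1 := fun η hη => ⟨hη.1, hη.2.trans_lt hx2.2⟩
    -- If `Σ*(0)` were finite, `s*` would be integrable near `0`, hence `1 / Π` bounded there.
    have hint : IntegrableOn D'.s (Ioc 0 (x / 2)) := by
      refine integrableOn_of_lintegral_weight_lt_top (w := fun η => D'.M x - D'.M η)
        (δ := D'.M x - D'.M (x / 2)) measurableSet_Ioc (D'.continuousOn_s.mono hsub)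
        (fun η _ => (D'.s_pos η).le)
        (sub_pos.2 (D'.strictMonoOn_M hx2 hx (half_lt_self hx.1))) (fun η hη => ?_)
        ((lintegral_mono_set (Ioc_subset_Ioc_right (half_lt_self hx.1).le)).trans_lt
          (lt_top_iff_ne_top.2 hne))
      have := D'.strictMonoOn_M.monotoneOn (hsub hη) hx2 hη.2
      linarith
    have hbdd : ∀ η ∈ Ioo 0 (x / 2), C * ((D.statCDF η)⁻¹ - (D.statCDF (x / 2))⁻¹) ≤
        ∫ t in Ioc 0 (x / 2), D'.s t := by
      intro η hη
      have hη' := hsub (Ioo_subset_Ioc_self hη)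
      rw [← hS hx2 hη', ← intervalIntegral.integral_eq_sub_of_hasDerivAt
        (fun t ht => D'.hasDerivAt_S (ordConnected_Ioo.uIcc_subset hη' hx2 ht))
        (intervalIntegrable_of_continuousOn_Ioo D'.continuousOn_s hη' hx2),
        intervalIntegral.integral_of_le hη.2.le]
      exact setIntegral_mono_set hint (ae_of_all _ fun t => (D'.s_pos t).le)
        (Ioc_subset_Ioc_left hη.1.le).eventuallyLE
    have hlim : Tendsto (fun η => C * ((D.statCDF η)⁻¹ - (D.statCDF (x / 2))⁻¹)) (𝓝[>] 0)
        atTop := by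
      refine Tendsto.const_mul_atTop hC ?_
      simp only [sub_eq_add_neg]
      exact tendsto_atTop_add_const_right _ _
        (tendsto_inv_nhdsGT_zero.comp (tendsto_statCDF_zero hm))
    obtain ⟨η, h1, h2⟩ := ((hlim.eventually_gt_atTop (∫ t in Ioc 0 (x / 2), D'.s t)).and
      (Ioo_mem_nhdsGT hx2.1)).exists
    exact (hbdd η h2).not_gt h1

lemma dual_isRegularAtOne (h₀ : D.IsReflectingAtZero) (h₁ : D.IsReflectingAtOne)
    (hb : ContDiffOn ℝ 1 D.b (Ioo 0 1)) (hdual : D.IsStrongStationaryDual D') :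
    D'.IsRegularAtOne := by
  have hm := integrableOn_m h₀.1 h₁.1
  have hs := integrableOn_s h₀.1 h₁.1
  have hc := mass_pos hm
  obtain ⟨C, hC, hCx⟩ := exists_dual_s_eq h₀ h₁ hb hdual
  intro x hx
  have hsub : Ico x 1 ⊆ Ioo (0 : ℝ) 1 := fun η hη => ⟨hx.1.trans_le hη.1, hη.2⟩
  have hPx := statCDF_pos hm ⟨hx.1, hx.2.le⟩
  have hP1 := statCDF_pos hm (x := 1) (by simp)
  -- Near `1`, `m*` is dominated by `s` and `s*` by `π`.
  have hm' : ∀ η ∈ Ico x 1, D'.m η ≤ D.mass / C * D.statCDF 1 ^ 2 * D.s η := by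
    intro η hη
    have hη' := hsub hη
    have hP := statCDF_pos hm ⟨hη'.1, hη'.2.le⟩
    have hle := statCDF_mono hm hη'.1.le hη'.2.le le_rfl
    have hsη := D.s_pos η
    rw [(hCx η hη').2]
    calc D.mass / C * (D.s η * D.statCDF η ^ 2) ≤ D.mass / C * (D.s η * D.statCDF 1 ^ 2) := by
          gcongr
      _ = _ := by ring
  have hm'int : IntegrableOn D'.m (Ico x 1) := by
    refine Integrable.mono' ((hs.mono_set hsub).const_mul (D.mass / C * D.statCDF 1 ^ 2))
      ((D'.continuousOn_m.mono hsub).aestronglyMeasurable measurableSet_Ico)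
      ((ae_restrict_iff' measurableSet_Ico).2 (ae_of_all _ fun η hη => ?_))
    rw [Real.norm_of_nonneg (D'.m_pos (hsub hη)).le]
    exact hm' η hη
  constructor
  · refine lintegral_ofReal_lt_top_of_le
      (K := C * (D.statCDF x)⁻¹ * (D.mass / C * D.statCDF 1 ^ 2)) hs measurableSet_Ico hsub
      fun η hη => ?_
    have hη' := hsub hη
    have hP := statCDF_pos hm ⟨hη'.1, hη'.2.le⟩
    rw [dual_S_sub hm (fun x hx => (hCx x hx).1) hη' hx, mul_assoc (C * _)]
    refine mul_le_mul ?_ (hm' η hη) (D'.m_pos hη').le (by positivity)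
    have := inv_pos.2 hP
    gcongr
    linarith
  · refine lintegral_ofReal_lt_top_of_le
      (K := (∫ t in Ico x 1, D'.m t) * (C * ((D.statCDF x)⁻¹ ^ 2)))
      (hm.div_const D.mass) measurableSet_Ico hsub fun η hη => ?_
    have hη' := hsub hη
    have hp := statDensity_pos hm hη'
    have hle := statCDF_mono hm hx.1.le hη.1 hη.2.le
    rw [mul_assoc]
    refine mul_le_mul ?_ ?_ (D'.s_pos η).le ?_
    · rw [← intervalIntegral.integral_eq_sub_of_hasDerivAt
        (fun t ht => D'.hasDerivAt_M (ordConnected_Ioo.uIcc_subset hx hη' ht))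
        (intervalIntegrable_of_continuousOn_Ioo D'.continuousOn_m hx hη'),
        intervalIntegral.integral_of_le hη.1]
      refine setIntegral_mono_set hm'int ?_
        (show Ioc x η ⊆ Ico x 1 from fun t ht => ⟨ht.1.le, ht.2.trans_lt hη.2⟩).eventuallyLE
      exact (ae_restrict_iff' measurableSet_Ico).2
        (ae_of_all _ fun t ht => (D'.m_pos (hsub ht)).le)
    · rw [(hCx η hη').1, ← statDensity_eq, inv_pow, mul_assoc, ← div_eq_inv_mul]
      gcongr
    · exact setIntegral_nonneg measurableSet_Ico fun t ht => (D'.m_pos (hsub ht)).le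

/-! ### Density of the range of the link operator -/

/-- The algebra of functions on `[0,1]` that extend to a `C¹` function constant near `0` and
near `1`. -/
def flatAtEnds : Subalgebra ℝ C(unitInterval, ℝ) where
  carrier := {g | ∃ G : ℝ → ℝ, ContDiff ℝ 1 G ∧ tsupport (deriv G) ⊆ Ioo 0 1 ∧
    ∀ x : unitInterval, g x = G x}
  mul_mem' := by
    rintro g h ⟨G, hG, hGs, hgG⟩ ⟨H, hH, hHs, hhH⟩
    refine ⟨G * H, hG.mul hH, ?_, fun x => by simp [hgG, hhH]⟩
    have : deriv (G * H) = deriv G * H + G * deriv H := by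
      ext x
      exact deriv_mul (hG.differentiable one_ne_zero x) (hH.differentiable one_ne_zero x)
    rw [this]
    exact (tsupport_add _ _).trans (union_subset ((tsupport_mul_subset_left).trans hGs)
      ((tsupport_mul_subset_right).trans hHs))
  add_mem' := by
    rintro g h ⟨G, hG, hGs, hgG⟩ ⟨H, hH, hHs, hhH⟩
    refine ⟨G + H, hG.add hH, ?_, fun x => by simp [hgG, hhH]⟩
    have : deriv (G + H) = deriv G + deriv H := by
      ext x
      exact deriv_add (hG.differentiable one_ne_zero x) (hH.differentiable one_ne_zero x)
    rw [this]
    exact (tsupport_add _ _).trans (union_subset hGs hHs)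
  algebraMap_mem' r := ⟨fun _ => r, contDiff_const, by simp [tsupport], fun x => rfl⟩

lemma flatAtEnds_separatesPoints : flatAtEnds.SeparatesPoints := by
  -- The primitive of a bump between `x` and `y` separates `x` from `y`.
  have key : ∀ x y : unitInterval, (x : ℝ) < y → ∃ g ∈ flatAtEnds, g x ≠ g y := by
    intro x y hxy
    have hx := x.2.1
    have hy := y.2.2
    obtain ⟨u, hu, hus, hu0, huz, hu1⟩ := exists_bump (c := ((x : ℝ) + y) / 2)
      (r := ((y : ℝ) - x) / 4) (by linarith) (by linarith) (by linarith)
    have hder : ∀ t, HasDerivAt (fun s => ∫ r in (0 : ℝ)..s, u r) (u t) t := fun t =>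
      intervalIntegral.integral_hasDerivAt_right (hu.continuous.intervalIntegrable _ _)
        (hu.continuous.stronglyMeasurableAtFilter _ _) hu.continuous.continuousAt
    have hd : deriv (fun s => ∫ r in (0 : ℝ)..s, u r) = u := funext fun t => (hder t).deriv
    refine ⟨⟨fun t => ∫ r in (0 : ℝ)..t, u r, ?_⟩, ⟨fun s => ∫ r in (0 : ℝ)..s, u r, ?_, ?_,
      fun _ => rfl⟩, ?_⟩
    · exact (continuous_iff_continuousAt.2 fun t => (hder t).continuousAt).comp
        continuous_subtype_val
    · rw [contDiff_one_iff_deriv, hd]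
      exact ⟨fun t => (hder t).differentiableAt, hu.continuous⟩
    · rwa [hd]
    · have hpos : 0 < ∫ r in (x : ℝ)..y, u r := by
        refine intervalIntegral.integral_pos hxy hu.continuous.continuousOn (fun r _ => hu0 r)
          ⟨((x : ℝ) + y) / 2, ⟨by linarith, by linarith⟩, by rw [hu1]; exact one_pos⟩
      rw [← intervalIntegral.integral_interval_sub_left (a := 0)
        (hu.continuous.intervalIntegrable _ _) (hu.continuous.intervalIntegrable _ _)] at hpos
      exact (sub_pos.1 hpos).ne
  intro x y hxy
  rcases lt_or_gt_of_ne (fun h => hxy (Subtype.ext h) : (x : ℝ) ≠ y) with h | h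
  · obtain ⟨g, hg, hne⟩ := key x y h
    exact ⟨g, ⟨g, hg, rfl⟩, hne⟩
  · obtain ⟨g, hg, hne⟩ := key y x h
    exact ⟨g, ⟨g, hg, rfl⟩, hne.symm⟩

/-- A `C¹` function `G` that is constant near both ends is `Λ k` for `k = G + G' Π / π`. -/
lemma exists_link_eq_of_mem_flatAtEnds (hm : IntegrableOn D.m (Ioo 0 1))
    {g : C(unitInterval, ℝ)} (hg : g ∈ flatAtEnds) : ∃ k : C(unitInterval, ℝ), ⇑g = D.link k := by
  obtain ⟨G, hG, hGs, hgG⟩ := hg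
  have hcont : Continuous fun x => deriv G x * (D.statCDF x / D.statDensity x) :=
    continuous_mul_of_tsupport_subset (hG.continuous_deriv le_rfl) hGs
      (((continuousOn_statCDF hm).mono Ioo_subset_Icc_self).div continuousOn_statDensity
        fun x hx => (statDensity_pos hm hx).ne')
  let k : C(unitInterval, ℝ) := ⟨fun x => G x + deriv G x * (D.statCDF x / D.statDensity x),
    (hG.continuous.add hcont).comp continuous_subtype_val⟩
  refine ⟨k, funext fun x => ?_⟩
  have hk : ∀ t ∈ Icc (0 : ℝ) 1,
      onReal k t = G t + deriv G t * (D.statCDF t / D.statDensity t) := fun t ht =>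
    onReal_of_mem _ ht
  rcases eq_or_ne x 0 with rfl | hx
  · have h0 : deriv G 0 = 0 := image_eq_zero_of_notMem_tsupport fun h => (hGs h).1.ne rfl
    have := hk 0 (by simp)
    rw [h0, zero_mul, add_zero] at this
    rw [link, if_pos rfl, hgG, ← onReal_coe k]
    exact this.symm
  have hx' : (x : ℝ) ∈ Ioc (0 : ℝ) 1 := ⟨unitInterval.pos_iff_ne_zero.2 hx, x.2.2⟩
  rw [← onReal_coe (D.link k), onReal_link hx', hgG]
  have hint : ∫ t in (0 : ℝ)..x, D.statDensity t * onReal k t = D.statCDF x * G x := by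
    have h := intervalIntegral.integral_eq_sub_of_hasDerivAt_of_le hx'.1.le
      (f := fun t => D.statCDF t * G t) (f' := fun t => D.statDensity t * onReal k t)
      (((continuousOn_statCDF hm).mono (Icc_subset_Icc_right hx'.2)).mul hG.continuous.continuousOn)
      (fun t ht => by
        have ht' : t ∈ Ioo (0 : ℝ) 1 := ⟨ht.1, ht.2.trans_le hx'.2⟩
        refine ((hasDerivAt_statCDF hm ht').mul
          (hG.differentiable one_ne_zero t).hasDerivAt).congr_deriv ?_
        have := (statDensity_pos hm ht').ne'
        rw [hk t (Ioo_subset_Icc_self ht')]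
        field_simp)
      (intervalIntegrable_statDensity_mul hm k (by simp) x.2)
    have h0 : D.statCDF 0 = 0 := intervalIntegral.integral_same
    simpa [h0] using h
  rw [hint, mul_div_cancel_left₀ _ (statCDF_pos hm hx').ne']

/-- The range of `Λ` on continuous functions is dense. -/
lemma exists_link_near (hm : IntegrableOn D.m (Ioo 0 1)) (h : C(unitInterval, ℝ)) {ε : ℝ}
    (hε : 0 < ε) : ∃ k g : C(unitInterval, ℝ), ⇑g = D.link k ∧ ‖g - h‖ < ε := by
  obtain ⟨⟨g, hg⟩, hgh⟩ := ContinuousMap.exists_mem_subalgebra_near_continuousMap_of_separatesPoints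
    flatAtEnds flatAtEnds_separatesPoints h ε hε
  obtain ⟨k, hk⟩ := exists_link_eq_of_mem_flatAtEnds hm hg
  exact ⟨k, g, hk, hgh⟩

/-! ### Absorption of the dual at `1` -/

/-- `Λ A f (1)` is the stationary mean of `A f`, which is zero. -/
lemma link_generator_one (hm : IntegrableOn D.m (Ioo 0 1)) (h₀ : D.IsReflectingAtZero)
    (h₁ : D.IsReflectingAtOne) {f : C(unitInterval, ℝ)} (hf : f ∈ D.domain) :
    D.link (D.generator f) 1 = 0 := by
  have h := onReal_link (D := D) (f := D.generator f) (x := 1) (by simp)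
  rw [integral_statDensity_mul_generator hm hf (by simp) (h₀.2 f hf) (h₁.2 f hf)] at h
  rw [← onReal_coe (D.link _)]
  simpa using h

/-- Since `(1 - A*) Λ f = Λ (1 - A) f` and `1 - A` is onto, the range of `1 - A*` on the image
under `Λ` of the domain of `A` is the dense range of `Λ`. By dissipativity, the graph of `A*` is
therefore the closure of its restriction to this image, on which `(A* g)(1) = 0`. -/
lemma dual_isAbsorbingAtOne (h₀ : D.IsReflectingAtZero) (h₁ : D.IsReflectingAtOne)
    (hdual : D.IsStrongStationaryDual D') : D'.IsAbsorbingAtOne := by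
  have hm := integrableOn_m h₀.1 h₁.1
  intro g hg
  by_contra hne
  have hε : 0 < |D'.generator g 1| / 2 := half_pos (abs_pos.2 hne)
  obtain ⟨k, l, hlk, hl⟩ := exists_link_near hm (g - D'.generator g) hε
  obtain ⟨f, hf, hfk⟩ := D.exists_sub_generator_eq k
  obtain ⟨g₁, hg₁, hg₁f, hgen⟩ := hdual.1 f hf
  have hl' : g₁ - D'.generator g₁ = l := by
    refine DFunLike.coe_injective ?_
    rw [hlk, ← hfk, link_sub hm, ← hg₁f, ← hgen]
    rfl
  have h1 : D'.generator g₁ 1 = 0 := by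
    rw [hgen]
    exact link_generator_one hm h₀ h₁ hf
  have hd : g₁ - g - D'.generator (g₁ - g) = l - (g - D'.generator g) := by
    rw [D'.generator_sub hg₁ hg, ← hl']
    abel
  have h2 : ‖g₁ - g‖ < |D'.generator g 1| / 2 := by
    refine (D'.norm_le_norm_sub_generator (D'.sub_mem_domain hg₁ hg)).trans_lt ?_
    rwa [hd]
  have h3 : D'.generator g 1 = (l - (g - D'.generator g)) 1 - (g₁ - g) 1 := by
    rw [← hl']
    simp only [ContinuousMap.sub_apply, h1]
    ring
  have h4 : |(l - (g - D'.generator g)) 1| ≤ ‖l - (g - D'.generator g)‖ :=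
    (l - (g - D'.generator g)).norm_coe_le_norm 1
  have h5 : |(g₁ - g) 1| ≤ ‖g₁ - g‖ := (g₁ - g).norm_coe_le_norm 1
  have h6 := abs_sub ((l - (g - D'.generator g)) 1) ((g₁ - g) 1)
  rw [← h3] at h6
  linarith

end Diffusion

end StrongStationary

end

theorem mainTheorem1 {Ω Ω' : Type*} [MeasurableSpace Ω] [MeasurableSpace Ω']
    (D : StrongStationary.Diffusion Ω) (D' : StrongStationary.Diffusion Ω')
    (h₀ : D.IsReflectingAtZero) (h₁ : D.IsReflectingAtOne)
    (hb : ContDiffOn ℝ 1 D.b (Ioo 0 1))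
    (hdual : D.IsStrongStationaryDual D') :
    (∀ f ∈ D'.domain, ∀ x : unitInterval, (x : ℝ) ∈ Ioo (0 : ℝ) 1 →
      D'.generator f x =
        (1 / 2 * deriv D.b x - D.a x + D.b x * (D.statDensity x / D.statCDF x)) *
            deriv (StrongStationary.onReal f) x +
          1 / 2 * D.b x * deriv (deriv (StrongStationary.onReal f)) x) ∧
    D'.IsEntranceAtZero ∧ D'.IsRegularAtOne ∧ D'.IsAbsorbingAtOne := by
  refine ⟨fun f hf x hx => ?_, StrongStationary.Diffusion.dual_isEntranceAtZero h₀ h₁ hb hdual,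
    StrongStationary.Diffusion.dual_isRegularAtOne h₀ h₁ hb hdual,
    StrongStationary.Diffusion.dual_isAbsorbingAtOne h₀ h₁ hdual⟩
  obtain ⟨hbb, haa⟩ := StrongStationary.Diffusion.dual_coefficients h₀ h₁ hb hdual hx
  rw [D'.generator_eq f hf x hx, hbb, haa]
  ring
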